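/- Let $\mathbb K$ be a field. An \emph{algebra with bracket} (AWB) is an associative, not necessarily commutative or unital, $\mathbb K$-algebra $A$ with a bilinear map $[-,-]:A\times A\to A$ such that $[ab,c]=[a,c]b+a[b,c]$ for all $a,b,c\in A$; homomorphisms are linear maps preserving product and bracket. For two-sided ideals $I,J$ of $A$, $[[I,J]]$ denotes the span of all $ij,\ ji,\ [i,j],\ [j,i]$ with $i\in I$, $j\in J$. Let $H_1^{AWB}(A)=\ker d_1/\operatorname{im} d_2$, where $d_1:A^{\otimes2}\oplus A^{\otimes2}\to A$ and $d_2:A^{\otimes3}\oplus A^{\otimes3}\to A^{\otimes2}\oplus A^{\otimes2}$ are given (writing $\circ$ for tensors in the second summands) by $d_1(a\otimes b)=ab$, $d_1(a\circ b)=[a,b]$, $d_2(a\otimes b\otimes c)=ab\otimes c-a\otimes bc$ and $d_2(a\circ b\circ c)=[a,c]\otimes b+a\otimes[b,c]-ab\circ c$. An extension $0\to N\to G\xrightarrow{\pi}Q\to0$ of AWB's is \emph{central} if $[[N,G]]=0$. It is a \emph{stem cover} of $Q$, and $G$ is called a \emph{cover} of $Q$, if it is central, $\pi$ induces an isomorphism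 $G/[[G,G]]\to Q/[[Q,Q]]$, and the induced map $H_1^{AWB}(G)\to H_1^{AWB}(Q)$ is zero. \textbf{Proposition.} Every finite-dimensional algebra with bracket $Q$ over $\mathbb K$ has at least one cover; more precisely, there is a stem cover $0\to N\to G\to Q\to0$ with $N\cong H_1^{AWB}(Q)$. Moreover, $Q$ has a free presentation, and for every free presentation $0\to R\to F\xrightarrow{\rho}Q\to0$ ($F$ a free AWB on a set, $\rho$ surjective, $R=\ker\rho$) there is a two-sided ideal $S$ of $F$ with $[[R,F]]\subseteq S\subseteq R$ such that $S/[[R,F]]$ is a complement of $(R\cap[[F,F]])/[[R,F]]$ in $R/[[R,F]]$, the extension $0\to R/S\to F/S\to Q\to 0$ induced by $\rho$ is a stem cover of $Q$, and $R/S\cong H_1^{AWB}(Q)$. -/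

import Mathlib

open scoped TensorProduct

universe u v w

/-- An algebra with bracket over a field `K`: a vector space with an associative (not necessarily
commutative or unital) bilinear product and a bilinear bracket such that
`[ab, c] = [a, c] b + a [b, c]`. -/
class AWB (K : Type*) (A : Type*) [Field K] [AddCommGroup A] [Module K A] where
  /-- the product -/
  mul : A →ₗ[K] A →ₗ[K] A
  /-- the bracket -/
  bracket : A →ₗ[K] A →ₗ[K] A
  mul_assoc : ∀ a b c : A, mul (mul a b) c = mul a (mul b c)
  bracket_mul : ∀ a b c : A,
    bracket (mul a b) c = mul (bracket a c) b + mul a (bracket b c)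

namespace AWB


section Basic

variable (K : Type u) [Field K]

/-- Homomorphisms of algebras with bracket. -/
structure Hom (A : Type*) (B : Type*) [AddCommGroup A] [Module K A] [AWB K A]
    [AddCommGroup B] [Module K B] [AWB K B] extends A →ₗ[K] B where
  map_mul : ∀ a b : A, toLinearMap (mul (K := K) a b)
    = mul (K := K) (toLinearMap a) (toLinearMap b)
  map_bracket : ∀ a b : A, toLinearMap (bracket (K := K) a b)
    = bracket (K := K) (toLinearMap a) (toLinearMap b)

/-- Two-sided ideals of an algebra with bracket. -/
structure TwoSided (A : Type*) [AddCommGroup A] [Module K A] [AWB K A] extends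
    Submodule K A where
  mul_left_mem : ∀ a x : A, x ∈ toSubmodule → mul (K := K) a x ∈ toSubmodule
  mul_right_mem : ∀ a x : A, x ∈ toSubmodule → mul (K := K) x a ∈ toSubmodule
  bracket_left_mem : ∀ a x : A, x ∈ toSubmodule → bracket (K := K) a x ∈ toSubmodule
  bracket_right_mem : ∀ a x : A, x ∈ toSubmodule → bracket (K := K) x a ∈ toSubmodule

end Basic

section Ideals

variable {K : Type u} [Field K]
variable {A : Type*} [AddCommGroup A] [Module K A]

/-- The bilinear operation induced on `A ⧸ S` by a bilinear operation on `A` that `S` absorbs on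
both sides. -/
def quotOp (m : A →ₗ[K] A →ₗ[K] A) (S : Submodule K A) (hl : ∀ a x : A, x ∈ S → m a x ∈ S)
    (hr : ∀ a x : A, x ∈ S → m x a ∈ S) : (A ⧸ S) →ₗ[K] (A ⧸ S) →ₗ[K] (A ⧸ S) :=
  S.liftQ
    { toFun := fun a => S.mapQ S (m a) (fun x hx => hl a x hx)
      map_add' := fun a b => by
        ext x
        simp
      map_smul' := fun c a => by
        ext x
        simp }
    (fun x hx => by
      rw [LinearMap.mem_ker]
      ext a
      simpa using hr a x hx)

@[simp] theorem quotOp_mk (m : A →ₗ[K] A →ₗ[K] A) (S : Submodule K A)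
    (hl : ∀ a x : A, x ∈ S → m a x ∈ S) (hr : ∀ a x : A, x ∈ S → m x a ∈ S) (a b : A) :
    quotOp m S hl hr (Submodule.Quotient.mk a) (Submodule.Quotient.mk b)
      = Submodule.Quotient.mk (m a b) := rfl

variable [AWB K A]

/-- The quotient of an algebra with bracket by a two-sided ideal. -/
instance (S : TwoSided K A) : AWB K (A ⧸ S.toSubmodule) where
  mul := quotOp mul S.toSubmodule S.mul_left_mem S.mul_right_mem
  bracket := quotOp bracket S.toSubmodule S.bracket_left_mem S.bracket_right_mem
  mul_assoc a b c := by
    obtain ⟨a, rfl⟩ := Submodule.Quotient.mk_surjective _ a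
    obtain ⟨b, rfl⟩ := Submodule.Quotient.mk_surjective _ b
    obtain ⟨c, rfl⟩ := Submodule.Quotient.mk_surjective _ c
    simp [AWB.mul_assoc]
  bracket_mul a b c := by
    obtain ⟨a, rfl⟩ := Submodule.Quotient.mk_surjective _ a
    obtain ⟨b, rfl⟩ := Submodule.Quotient.mk_surjective _ b
    obtain ⟨c, rfl⟩ := Submodule.Quotient.mk_surjective _ c
    simp [AWB.bracket_mul]

/-- A two-sided ideal is itself an algebra with bracket. -/
instance (I : TwoSided K A) : AWB K I.toSubmodule where
  mul := LinearMap.mk₂ K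
    (fun a b => ⟨mul (K := K) (a : A) (b : A), I.mul_left_mem a b b.2⟩)
    (by intros; ext; simp) (by intros; ext; simp) (by intros; ext; simp) (by intros; ext; simp)
  bracket := LinearMap.mk₂ K
    (fun a b => ⟨bracket (K := K) (a : A) (b : A), I.bracket_left_mem a b b.2⟩)
    (by intros; ext; simp) (by intros; ext; simp) (by intros; ext; simp) (by intros; ext; simp)
  mul_assoc a b c := by
    ext
    simp [AWB.mul_assoc]
  bracket_mul a b c := by
    ext
    simp [AWB.bracket_mul]

variable (K) in
/-- The commutator `[[I, J]]`: the linear span of all `ij`, `ji`, `[i, j]`, `[j, i]` with `i ∈ I`,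
`j ∈ J`.  When `I` and `J` are two-sided ideals, this span is already closed under the operations
with elements of `I` and of `J` (see `commutator_absorbs`), so it is the two-sided ideal of `I` and
`J` generated by these elements. -/
def commutator (I J : Submodule K A) : Submodule K A :=
  Submodule.span K {x | ∃ i ∈ I, ∃ j ∈ J, x = mul (K := K) i j ∨ x = mul (K := K) j i ∨
    x = bracket (K := K) i j ∨ x = bracket (K := K) j i}

theorem commutator_comm (I J : Submodule K A) : commutator K I J = commutator K J I := by
  unfold commutator
  congr 1
  ext x
  constructor
  · rintro ⟨i, hi, j, hj, h⟩
    exact ⟨j, hj, i, hi, by tauto⟩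
  · rintro ⟨i, hi, j, hj, h⟩
    exact ⟨j, hj, i, hi, by tauto⟩

theorem commutator_le_left (I : TwoSided K A) (J : Submodule K A) :
    commutator K I.toSubmodule J ≤ I.toSubmodule := by
  refine Submodule.span_le.2 ?_
  rintro x ⟨i, hi, j, hj, rfl | rfl | rfl | rfl⟩
  · exact I.mul_right_mem _ _ hi
  · exact I.mul_left_mem _ _ hi
  · exact I.bracket_right_mem _ _ hi
  · exact I.bracket_left_mem _ _ hi

theorem commutator_absorbs (I : TwoSided K A) (J : Submodule K A) {x j : A}
    (hx : x ∈ commutator K I.toSubmodule J) (hj : j ∈ J) :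
    mul (K := K) x j ∈ commutator K I.toSubmodule J ∧
    mul (K := K) j x ∈ commutator K I.toSubmodule J ∧
    bracket (K := K) x j ∈ commutator K I.toSubmodule J ∧
    bracket (K := K) j x ∈ commutator K I.toSubmodule J := by
  have hi := commutator_le_left I J hx
  exact ⟨Submodule.subset_span ⟨x, hi, j, hj, by tauto⟩,
    Submodule.subset_span ⟨x, hi, j, hj, by tauto⟩,
    Submodule.subset_span ⟨x, hi, j, hj, by tauto⟩,
    Submodule.subset_span ⟨x, hi, j, hj, by tauto⟩⟩

variable (K A) in
/-- The derived algebra `[[A, A]]`. -/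
def derived : Submodule K A := commutator K (⊤ : Submodule K A) ⊤

end Ideals

section Homs

variable {K : Type u} [Field K]
variable {A : Type*} [AddCommGroup A] [Module K A] [AWB K A]
variable {B : Type*} [AddCommGroup B] [Module K B] [AWB K B]

/-- The kernel of a homomorphism, as a two-sided ideal. -/
def Hom.ker (f : Hom K A B) : TwoSided K A where
  toSubmodule := LinearMap.ker f.toLinearMap
  mul_left_mem a x hx := by
    rw [LinearMap.mem_ker] at hx ⊢
    rw [f.map_mul, hx, map_zero]
  mul_right_mem a x hx := by
    rw [LinearMap.mem_ker] at hx ⊢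
    rw [f.map_mul, hx, map_zero, LinearMap.zero_apply]
  bracket_left_mem a x hx := by
    rw [LinearMap.mem_ker] at hx ⊢
    rw [f.map_bracket, hx, map_zero]
  bracket_right_mem a x hx := by
    rw [LinearMap.mem_ker] at hx ⊢
    rw [f.map_bracket, hx, map_zero, LinearMap.zero_apply]

/-- The inclusion of a two-sided ideal. -/
def TwoSided.incl (I : TwoSided K A) : Hom K I.toSubmodule A where
  toLinearMap := I.toSubmodule.subtype
  map_mul _ _ := rfl
  map_bracket _ _ := rfl

/-- The homomorphism `A ⧸ S → B` induced by a homomorphism `f : A → B` that vanishes on `S`. -/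
def TwoSided.lift (S : TwoSided K A) (f : Hom K A B)
    (h : S.toSubmodule ≤ f.ker.toSubmodule) : Hom K (A ⧸ S.toSubmodule) B where
  toLinearMap := S.toSubmodule.liftQ f.toLinearMap h
  map_mul a b := by
    obtain ⟨a, rfl⟩ := Submodule.Quotient.mk_surjective _ a
    obtain ⟨b, rfl⟩ := Submodule.Quotient.mk_surjective _ b
    exact f.map_mul a b
  map_bracket a b := by
    obtain ⟨a, rfl⟩ := Submodule.Quotient.mk_surjective _ a
    obtain ⟨b, rfl⟩ := Submodule.Quotient.mk_surjective _ b
    exact f.map_bracket a b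

theorem TwoSided.lift_surjective (S : TwoSided K A) (f : Hom K A B)
    (h : S.toSubmodule ≤ f.ker.toSubmodule) (hf : Function.Surjective f.toLinearMap) :
    Function.Surjective (S.lift f h).toLinearMap := fun b => by
  obtain ⟨a, rfl⟩ := hf b
  exact ⟨Submodule.Quotient.mk a, rfl⟩

theorem Hom.map_derived_le (f : Hom K A B) :
    derived K A ≤ (derived K B).comap f.toLinearMap := by
  refine Submodule.span_le.2 ?_
  rintro x ⟨i, -, j, -, h⟩
  refine Submodule.subset_span ⟨f.toLinearMap i, trivial, f.toLinearMap j, trivial, ?_⟩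
  rcases h with rfl | rfl | rfl | rfl
  · exact Or.inl (f.map_mul _ _)
  · exact Or.inr (Or.inl (f.map_mul _ _))
  · exact Or.inr (Or.inr (Or.inl (f.map_bracket _ _)))
  · exact Or.inr (Or.inr (Or.inr (f.map_bracket _ _)))

/-- The map `A / [[A, A]] → B / [[B, B]]` induced by a homomorphism `A → B`. -/
def Hom.abMap (f : Hom K A B) : (A ⧸ derived K A) →ₗ[K] (B ⧸ derived K B) :=
  (derived K A).mapQ (derived K B) f.toLinearMap f.map_derived_le

end Homs

noncomputable section Homology

variable (K : Type u) [Field K]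
variable (A : Type v) [AddCommGroup A] [Module K A] [AWB K A]

/-- The boundary map from degree one to degree zero,
`a ⊗ b ↦ ab` on the first summand and `a ∘ b ↦ [a, b]` on the second. -/
def d₁ : ((A ⊗[K] A) × (A ⊗[K] A)) →ₗ[K] A :=
  LinearMap.coprod (TensorProduct.lift mul) (TensorProduct.lift bracket)

/-- The map `a ⊗ b ⊗ c ↦ ab ⊗ c`. -/
def mulFirst : (A ⊗[K] (A ⊗[K] A)) →ₗ[K] (A ⊗[K] A) :=
  (TensorProduct.lift (mul (K := K) (A := A))).rTensor A ∘ₗ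
    (TensorProduct.assoc K A A A).symm.toLinearMap

/-- The map `a ⊗ b ⊗ c ↦ a ⊗ bc`. -/
def mulLast : (A ⊗[K] (A ⊗[K] A)) →ₗ[K] (A ⊗[K] A) :=
  (TensorProduct.lift (mul (K := K) (A := A))).lTensor A

/-- The map `a ⊗ b ⊗ c ↦ a ⊗ [b, c]`. -/
def bracketLast : (A ⊗[K] (A ⊗[K] A)) →ₗ[K] (A ⊗[K] A) :=
  (TensorProduct.lift (bracket (K := K) (A := A))).lTensor A

/-- The map `a ⊗ b ⊗ c ↦ [a, c] ⊗ b`. -/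
def bracketFirst : (A ⊗[K] (A ⊗[K] A)) →ₗ[K] (A ⊗[K] A) :=
  (TensorProduct.lift (bracket (K := K) (A := A))).rTensor A ∘ₗ
    (TensorProduct.assoc K A A A).symm.toLinearMap ∘ₗ
      (TensorProduct.comm K A A).toLinearMap.lTensor A

/-- The boundary map from degree two to degree one: `a ⊗ b ⊗ c ↦ ab ⊗ c - a ⊗ bc` on the first
summand and `a ∘ b ∘ c ↦ [a, c] ⊗ b + a ⊗ [b, c] - ab ∘ c` on the second. -/
def d₂ : ((A ⊗[K] (A ⊗[K] A)) × (A ⊗[K] (A ⊗[K] A))) →ₗ[K] ((A ⊗[K] A) × (A ⊗[K] A)) :=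
  LinearMap.coprod (LinearMap.inl K _ _ ∘ₗ (mulFirst K A - mulLast K A))
    (LinearMap.inl K _ _ ∘ₗ (bracketFirst K A + bracketLast K A)
      - LinearMap.inr K _ _ ∘ₗ mulFirst K A)

theorem d₂_inl (a b c : A) : d₂ K A (a ⊗ₜ (b ⊗ₜ c), 0)
    = ((mul (K := K) a b) ⊗ₜ c - a ⊗ₜ (mul (K := K) b c), 0) := by
  simp [d₂, mulFirst, mulLast]

theorem d₂_inr (a b c : A) : d₂ K A (0, a ⊗ₜ (b ⊗ₜ c))
    = ((bracket (K := K) a c) ⊗ₜ b + a ⊗ₜ (bracket (K := K) b c),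
        -((mul (K := K) a b) ⊗ₜ c)) := by
  simp [d₂, mulFirst, bracketFirst, bracketLast]

theorem d₁_comp_d₂ : d₁ K A ∘ₗ d₂ K A = 0 := by
  ext a b c
  · simp [d₁, d₂, mulFirst, mulLast, AWB.mul_assoc]
  · simp [d₁, d₂, mulFirst, bracketFirst, bracketLast, AWB.bracket_mul]

/-- The first homology with trivial coefficients (the Schur multiplier) of an algebra with
bracket: cycles `ker d₁` modulo boundaries `im d₂`. -/
abbrev H₁ : Type v :=
  LinearMap.ker (d₁ K A) ⧸ (LinearMap.range (d₂ K A)).submoduleOf (LinearMap.ker (d₁ K A))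

variable {K A}
variable {B : Type w} [AddCommGroup B] [Module K B] [AWB K B]

/-- The map induced by a homomorphism on chains of degree one. -/
def Hom.chainMap₁ (f : Hom K A B) :
    ((A ⊗[K] A) × (A ⊗[K] A)) →ₗ[K] ((B ⊗[K] B) × (B ⊗[K] B)) :=
  (TensorProduct.map f.toLinearMap f.toLinearMap).prodMap
    (TensorProduct.map f.toLinearMap f.toLinearMap)

/-- The map induced by a homomorphism on chains of degree two. -/
def Hom.chainMap₂ (f : Hom K A B) :
    ((A ⊗[K] (A ⊗[K] A)) × (A ⊗[K] (A ⊗[K] A))) →ₗ[K]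
      ((B ⊗[K] (B ⊗[K] B)) × (B ⊗[K] (B ⊗[K] B))) :=
  (TensorProduct.map f.toLinearMap (TensorProduct.map f.toLinearMap f.toLinearMap)).prodMap
    (TensorProduct.map f.toLinearMap (TensorProduct.map f.toLinearMap f.toLinearMap))

theorem Hom.d₁_chainMap (f : Hom K A B) :
    d₁ K B ∘ₗ f.chainMap₁ = f.toLinearMap ∘ₗ d₁ K A := by
  ext a b
  · simp [d₁, Hom.chainMap₁, f.map_mul]
  · simp [d₁, Hom.chainMap₁, f.map_bracket]

theorem Hom.d₂_chainMap (f : Hom K A B) :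
    d₂ K B ∘ₗ f.chainMap₂ = f.chainMap₁ ∘ₗ d₂ K A := by
  ext a b c <;>
  simp [d₂, mulFirst, mulLast, bracketFirst, bracketLast, Hom.chainMap₁, Hom.chainMap₂,
    f.map_mul, f.map_bracket]

theorem Hom.chainMap₁_mem_ker (f : Hom K A B) :
    ∀ z ∈ LinearMap.ker (d₁ K A), f.chainMap₁ z ∈ LinearMap.ker (d₁ K B) := fun z hz => by
  have h := LinearMap.congr_fun f.d₁_chainMap z
  rw [LinearMap.mem_ker] at hz ⊢
  simpa [hz] using h

/-- The map induced by a homomorphism on first homology. -/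
def Hom.H₁map (f : Hom K A B) : H₁ K A →ₗ[K] H₁ K B :=
  Submodule.mapQ _ _ (f.chainMap₁.restrict f.chainMap₁_mem_ker) (by
    rintro z ⟨y, hy⟩
    exact ⟨f.chainMap₂ y, by
      have h := LinearMap.congr_fun f.d₂_chainMap y
      simp only [LinearMap.comp_apply] at h
      rw [h, hy]
      rfl⟩)

end Homology

section Extensions

variable (K : Type u) [Field K]

/-- An extension `0 → N → G → Q → 0` of algebras with bracket. -/
structure Extension (N : Type*) (G : Type*) (Q : Type*)
    [AddCommGroup N] [Module K N] [AWB K N] [AddCommGroup G] [Module K G] [AWB K G]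
    [AddCommGroup Q] [Module K Q] [AWB K Q] where
  χ : Hom K N G
  π : Hom K G Q
  injective : Function.Injective χ.toLinearMap
  exact : LinearMap.range χ.toLinearMap = LinearMap.ker π.toLinearMap
  surjective : Function.Surjective π.toLinearMap

variable {K}
variable {N : Type*} [AddCommGroup N] [Module K N] [AWB K N]
variable {G : Type*} [AddCommGroup G] [Module K G] [AWB K G]
variable {Q : Type*} [AddCommGroup Q] [Module K Q] [AWB K Q]

/-- The extension is central: `[[N, G]] = 0`. -/
def Extension.IsCentral (E : Extension K N G Q) : Prop :=
  commutator K (LinearMap.range E.χ.toLinearMap) ⊤ = ⊥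

/-- A stem extension: a central extension for which `π` induces an isomorphism
`G / [[G, G]] ≅ Q / [[Q, Q]]`. -/
def Extension.IsStem (E : Extension K N G Q) : Prop :=
  E.IsCentral ∧ Function.Bijective E.π.abMap

/-- A stem cover: a stem extension for which `π` induces the zero map `H₁(G) → H₁(Q)`. -/
def Extension.IsStemCover (E : Extension K N G Q) : Prop :=
  E.IsStem ∧ E.π.H₁map = 0

/-- The extension `0 → ker p → G → Q → 0` given by a surjective homomorphism `p`. -/
def Extension.ofSurjective (p : Hom K G Q) (hp : Function.Surjective p.toLinearMap) :
    Extension K p.ker.toSubmodule G Q where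
  χ := p.ker.incl
  π := p
  injective := Subtype.val_injective
  exact := Submodule.range_subtype _
  surjective := hp

end Extensions

noncomputable section Free

/-- Formal terms in two binary operations with variables in `X`. -/
inductive Term (X : Type w) : Type w
  | of : X → Term X
  | mul : Term X → Term X → Term X
  | bracket : Term X → Term X → Term X

variable (K : Type u) [Field K] (X : Type w)

/-- The bilinear product on linear combinations of terms. -/
def termMul : (Term X →₀ K) →ₗ[K] (Term X →₀ K) →ₗ[K] (Term X →₀ K) :=
  Finsupp.linearCombination K (fun s => Finsupp.lmapDomain K K (Term.mul s))

/-- The bilinear bracket on linear combinations of terms. -/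
def termBracket : (Term X →₀ K) →ₗ[K] (Term X →₀ K) →ₗ[K] (Term X →₀ K) :=
  Finsupp.linearCombination K (fun s => Finsupp.lmapDomain K K (Term.bracket s))

/-- The defining relations of an algebra with bracket, closed under the two operations with
arbitrary elements on either side. -/
inductive Relator : (Term X →₀ K) → Prop
  | assoc (a b c) : Relator
      (termMul K X (termMul K X a b) c - termMul K X a (termMul K X b c))
  | leibniz (a b c) : Relator
      (termBracket K X (termMul K X a b) c
        - (termMul K X (termBracket K X a c) b + termMul K X a (termBracket K X b c)))
  | mul_left (a x) : Relator x → Relator (termMul K X a x)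
  | mul_right (a x) : Relator x → Relator (termMul K X x a)
  | bracket_left (a x) : Relator x → Relator (termBracket K X a x)
  | bracket_right (a x) : Relator x → Relator (termBracket K X x a)

/-- The two-sided ideal generated by the defining relations of an algebra with bracket. -/
def relators : Submodule K (Term X →₀ K) := Submodule.span K {x | Relator K X x}

theorem relators_map (f : (Term X →₀ K) →ₗ[K] (Term X →₀ K))
    (hf : ∀ x, Relator K X x → Relator K X (f x)) (x : Term X →₀ K) (hx : x ∈ relators K X) :
    f x ∈ relators K X := by
  have h : relators K X ≤ (relators K X).comap f :=
    Submodule.span_le.2 fun y hy => Submodule.subset_span (hf y hy)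
  exact h hx

theorem relators_mul_left (a x : Term X →₀ K) (hx : x ∈ relators K X) :
    termMul K X a x ∈ relators K X :=
  relators_map K X (termMul K X a) (fun y hy => .mul_left a y hy) x hx

theorem relators_mul_right (a x : Term X →₀ K) (hx : x ∈ relators K X) :
    termMul K X x a ∈ relators K X :=
  relators_map K X ((termMul K X).flip a) (fun y hy => .mul_right a y hy) x hx

theorem relators_bracket_left (a x : Term X →₀ K) (hx : x ∈ relators K X) :
    termBracket K X a x ∈ relators K X :=
  relators_map K X (termBracket K X a) (fun y hy => .bracket_left a y hy) x hx

theorem relators_bracket_right (a x : Term X →₀ K) (hx : x ∈ relators K X) :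
    termBracket K X x a ∈ relators K X :=
  relators_map K X ((termBracket K X).flip a) (fun y hy => .bracket_right a y hy) x hx

/-- The free algebra with bracket on the set `X`. -/
abbrev Free : Type (max u w) := (Term X →₀ K) ⧸ relators K X

instance : AWB K (Free K X) where
  mul := quotOp (termMul K X) (relators K X) (relators_mul_left K X) (relators_mul_right K X)
  bracket := quotOp (termBracket K X) (relators K X) (relators_bracket_left K X)
    (relators_bracket_right K X)
  mul_assoc a b c := by
    obtain ⟨a, rfl⟩ := Submodule.Quotient.mk_surjective _ a
    obtain ⟨b, rfl⟩ := Submodule.Quotient.mk_surjective _ b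
    obtain ⟨c, rfl⟩ := Submodule.Quotient.mk_surjective _ c
    simp only [quotOp_mk]
    rw [Submodule.Quotient.eq]
    exact Submodule.subset_span (.assoc a b c)
  bracket_mul a b c := by
    obtain ⟨a, rfl⟩ := Submodule.Quotient.mk_surjective _ a
    obtain ⟨b, rfl⟩ := Submodule.Quotient.mk_surjective _ b
    obtain ⟨c, rfl⟩ := Submodule.Quotient.mk_surjective _ c
    simp only [quotOp_mk]
    rw [← Submodule.Quotient.mk_add, Submodule.Quotient.eq]
    exact Submodule.subset_span (.leibniz a b c)

end Free

end AWB

/-! Everything is expressed through the chain complex. `[[A, A]]` is the image of `d₁`, and for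
surjective `f : A → B` the ideal `[[ker f, A]]` is the image under `d₁` of the one-chains killed by
`f` (`d₁_mem_commutator`, `exists_d₁_of_mem_commutator`).

A stem cover of any `A` comes from a universal cocycle. Over a field the class map on cycles extends
to a linear `φ` on all one-chains, and `φ ∘ d₂ = 0` is exactly the condition for `φ` to twist the
operations of `A` into an algebra with bracket on `A × H₁ K A`. There `d₁` sends a chain lying over
`z` to `(d₁ z, φ z)`, which yields all the required properties (`exists_stemCover`).

A stem cover of a free `F` splits, yet induces zero on `H₁`; hence `H₁(F) = 0`
(`Free.mem_range_d₂`). For a free presentation, any subspace between `[[R, F]]` and `R` is an ideal,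
so `S` is found by linear algebra, and the vanishing of `H₁(F)` makes `F/S → Q` zero on `H₁`
(`H₁map_lift_eq_zero`). In both constructions the kernel is identified with `H₁(Q)` by lifting a
cycle of `Q` and applying `d₁` (`nonempty_ker_equiv_H₁`). -/

/-- Relative complements of subspaces: for `C ≤ D ≤ R` there is `T` with `T ⊓ D = C` and
`T ⊔ D = R`. -/
theorem exists_relative_complement {K V : Type*} [Field K] [AddCommGroup V] [Module K V]
    {C D R : Submodule K V} (hCD : C ≤ D) (hDR : D ≤ R) :
    ∃ T : Submodule K V, T ⊓ D = C ∧ T ⊔ D = R := by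
  obtain ⟨W, h⟩ := Submodule.exists_isCompl D
  have hmod : W ⊓ R ⊔ D = R := by
    rw [sup_comm, ← sup_inf_assoc_of_le W hDR, h.sup_eq_top, top_inf_eq]
  -- By the modular law `W ⊓ R` complements `D` in `R`; adding `C` makes the intersection with `D`
  -- exactly `C`.
  refine ⟨C ⊔ W ⊓ R, ?_, ?_⟩
  · rw [sup_inf_assoc_of_le _ hCD, inf_right_comm, h.symm.inf_eq_bot, bot_inf_eq, sup_bot_eq]
  · rw [sup_assoc, hmod, sup_eq_right.2 (hCD.trans hDR)]

namespace AWB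

/-- A bilinear operation sends `ker (f ⊗ f)` into any subspace that contains its values with one
argument in `ker f`. -/
theorem ker_map_le_comap_lift {K A B : Type*} [Field K] [AddCommGroup A] [Module K A]
    [AddCommGroup B] [Module K B] (f : A →ₗ[K] B) (hf : Function.Surjective f)
    (m : A →ₗ[K] A →ₗ[K] A) (S : Submodule K A)
    (hl : ∀ a x : A, f x = 0 → m a x ∈ S) (hr : ∀ a x : A, f x = 0 → m x a ∈ S) :
    LinearMap.ker (TensorProduct.map f f) ≤ S.comap (TensorProduct.lift m) := by
  have hex : Function.Exact (LinearMap.ker f).subtype f := LinearMap.exact_subtype_ker_map f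
  -- Right exactness: `ker (f ⊗ f)` is spanned by pure tensors with a factor in `ker f`.
  rw [TensorProduct.map_ker hex hf hex hf]
  refine sup_le ?_ ?_ <;> rintro _ ⟨z, rfl⟩
  · induction z with
    | zero => simp
    | add x y hx hy => rw [map_add]; exact add_mem hx hy
    | tmul a b => simpa using hl _ _ b.2
  · induction z with
    | zero => simp
    | add x y hx hy => rw [map_add]; exact add_mem hx hy
    | tmul a b => simpa using hr _ _ a.2

/-! ### Commutators, stem covers and homology in terms of chains -/

section Chains

variable {K : Type u} [Field K]
variable {A : Type*} [AddCommGroup A] [Module K A] [AWB K A]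
variable {B : Type*} [AddCommGroup B] [Module K B] [AWB K B]
variable {C : Type*} [AddCommGroup C] [Module K C] [AWB K C]

@[simp] theorem d₁_inl (a b : A) : d₁ K A (a ⊗ₜ[K] b, 0) = mul (K := K) a b := by
  simp [d₁]

@[simp] theorem d₁_inr (a b : A) : d₁ K A (0, a ⊗ₜ[K] b) = bracket (K := K) a b := by
  simp [d₁]

theorem derived_eq_range : derived K A = LinearMap.range (d₁ K A) := by
  apply le_antisymm
  · refine Submodule.span_le.2 ?_
    rintro x ⟨i, -, j, -, rfl | rfl | rfl | rfl⟩
    · exact ⟨(i ⊗ₜ j, 0), d₁_inl i j⟩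
    · exact ⟨(j ⊗ₜ i, 0), d₁_inl j i⟩
    · exact ⟨(0, i ⊗ₜ j), d₁_inr i j⟩
    · exact ⟨(0, j ⊗ₜ i), d₁_inr j i⟩
  · rw [d₁, LinearMap.range_coprod, sup_le_iff]
    constructor
    · rintro _ ⟨z, rfl⟩
      induction z with
      | zero => simp
      | add x y hx hy => rw [map_add]; exact add_mem hx hy
      | tmul a b => exact Submodule.subset_span ⟨a, trivial, b, trivial, Or.inl (by simp)⟩
    · rintro _ ⟨z, rfl⟩
      induction z with
      | zero => simp
      | add x y hx hy => rw [map_add]; exact add_mem hx hy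
      | tmul a b =>
        exact Submodule.subset_span ⟨a, trivial, b, trivial, Or.inr (Or.inr (Or.inl (by simp)))⟩

theorem d₁_chainMap_apply (f : Hom K A B) (z : (A ⊗[K] A) × (A ⊗[K] A)) :
    d₁ K B (f.chainMap₁ z) = f.toLinearMap (d₁ K A z) :=
  LinearMap.congr_fun f.d₁_chainMap z

theorem d₂_chainMap_apply (f : Hom K A B)
    (z : (A ⊗[K] (A ⊗[K] A)) × (A ⊗[K] (A ⊗[K] A))) :
    d₂ K B (f.chainMap₂ z) = f.chainMap₁ (d₂ K A z) :=
  LinearMap.congr_fun f.d₂_chainMap z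

theorem d₁_d₂_apply (z : (A ⊗[K] (A ⊗[K] A)) × (A ⊗[K] (A ⊗[K] A))) :
    d₁ K A (d₂ K A z) = 0 :=
  LinearMap.congr_fun (d₁_comp_d₂ K A) z

theorem chainMap₁_comp (f : Hom K A B) (g : Hom K B C) (h : Hom K A C)
    (e : g.toLinearMap ∘ₗ f.toLinearMap = h.toLinearMap) (z : (A ⊗[K] A) × (A ⊗[K] A)) :
    g.chainMap₁ (f.chainMap₁ z) = h.chainMap₁ z := by
  simp [Hom.chainMap₁, ← e, TensorProduct.map_comp]

theorem chainMap₁_surjective (f : Hom K A B) (hf : Function.Surjective f.toLinearMap) :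
    Function.Surjective f.chainMap₁ :=
  Function.Surjective.prodMap (TensorProduct.map_surjective hf hf)
    (TensorProduct.map_surjective hf hf)

theorem chainMap₂_surjective (f : Hom K A B) (hf : Function.Surjective f.toLinearMap) :
    Function.Surjective f.chainMap₂ :=
  Function.Surjective.prodMap
    (TensorProduct.map_surjective hf (TensorProduct.map_surjective hf hf))
    (TensorProduct.map_surjective hf (TensorProduct.map_surjective hf hf))

theorem d₁_mem_commutator (f : Hom K A B) (hf : Function.Surjective f.toLinearMap)
    {z : (A ⊗[K] A) × (A ⊗[K] A)} (hz : f.chainMap₁ z = 0) :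
    d₁ K A z ∈ commutator K f.ker.toSubmodule ⊤ := by
  obtain ⟨z₁, z₂⟩ := z
  have h₁ : TensorProduct.map f.toLinearMap f.toLinearMap z₁ = 0 := congrArg Prod.fst hz
  have h₂ : TensorProduct.map f.toLinearMap f.toLinearMap z₂ = 0 := congrArg Prod.snd hz
  have e : d₁ K A (z₁, z₂)
      = TensorProduct.lift (mul (K := K)) z₁ + TensorProduct.lift (bracket (K := K)) z₂ :=
    LinearMap.coprod_apply _ _ _
  rw [e]
  refine add_mem (ker_map_le_comap_lift f.toLinearMap hf (mul (K := K)) (commutator K _ ⊤) ?_ ?_ h₁)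
    (ker_map_le_comap_lift f.toLinearMap hf (bracket (K := K)) (commutator K _ ⊤) ?_ ?_ h₂)
  all_goals
    intro a x hx
    exact Submodule.subset_span ⟨x, hx, a, trivial, by tauto⟩

/-- Each spanning product or bracket is `d₁` of a pure tensor with a factor in `ker f`, which `f`
kills. -/
theorem exists_d₁_of_mem_commutator (f : Hom K A B) {x : A}
    (hx : x ∈ commutator K f.ker.toSubmodule ⊤) :
    ∃ z, f.chainMap₁ z = 0 ∧ d₁ K A z = x := by
  have h : commutator K f.ker.toSubmodule ⊤
      ≤ (LinearMap.ker f.chainMap₁).map (d₁ K A) := by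
    refine Submodule.span_le.2 ?_
    rintro x ⟨i, hi, j, -, h⟩
    have hi : f.toLinearMap i = 0 := hi
    rcases h with rfl | rfl | rfl | rfl
    · exact ⟨(i ⊗ₜ j, 0), by simp [Hom.chainMap₁, hi], d₁_inl i j⟩
    · exact ⟨(j ⊗ₜ i, 0), by simp [Hom.chainMap₁, hi], d₁_inl j i⟩
    · exact ⟨(0, i ⊗ₜ j), by simp [Hom.chainMap₁, hi], d₁_inr i j⟩
    · exact ⟨(0, j ⊗ₜ i), by simp [Hom.chainMap₁, hi], d₁_inr j i⟩
  exact h hx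

theorem H₁_mk_eq_zero {z : (A ⊗[K] A) × (A ⊗[K] A)} (hz : z ∈ LinearMap.ker (d₁ K A)) :
    (Submodule.Quotient.mk ⟨z, hz⟩ : H₁ K A) = 0 ↔ z ∈ LinearMap.range (d₂ K A) :=
  Submodule.Quotient.mk_eq_zero _

theorem H₁map_eq_zero_iff (f : Hom K A B) :
    f.H₁map = 0 ↔ ∀ z, d₁ K A z = 0 → f.chainMap₁ z ∈ LinearMap.range (d₂ K B) := by
  constructor
  · intro h z hz
    have := LinearMap.congr_fun h (Submodule.Quotient.mk ⟨z, hz⟩)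
    exact (H₁_mk_eq_zero (f.chainMap₁_mem_ker z hz)).1 this
  · intro h
    ext ⟨z, hz⟩
    exact (H₁_mk_eq_zero (f.chainMap₁_mem_ker z hz)).2 (h z hz)

theorem map_derived_eq (f : Hom K A B) (hf : Function.Surjective f.toLinearMap) :
    (derived K A).map f.toLinearMap = derived K B := by
  rw [derived_eq_range, derived_eq_range, ← LinearMap.range_comp, ← f.d₁_chainMap,
    LinearMap.range_comp, LinearMap.range_eq_top.2 (chainMap₁_surjective f hf), Submodule.map_top]

/-- If `f x` lies in `[[B, B]]`, it equals `f y` with `y` in `[[A, A]]`, and `x - y` lies in `ker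
f`, hence in `[[A, A]]`. -/
theorem abMap_bijective (f : Hom K A B) (hf : Function.Surjective f.toLinearMap)
    (hd : f.ker.toSubmodule ≤ derived K A) : Function.Bijective f.abMap := by
  constructor
  · rw [← LinearMap.ker_eq_bot, eq_bot_iff]
    intro x hx
    obtain ⟨x, rfl⟩ := Submodule.Quotient.mk_surjective _ x
    have hx : f.toLinearMap x ∈ derived K B := (Submodule.Quotient.mk_eq_zero _).1 hx
    rw [← map_derived_eq f hf] at hx
    obtain ⟨y, hy, hxy⟩ := hx
    refine (Submodule.Quotient.mk_eq_zero _).2 ?_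
    have h : x - y ∈ derived K A := hd (by
      change f.toLinearMap (x - y) = 0
      rw [map_sub, hxy, sub_self])
    simpa using add_mem h hy
  · intro b
    obtain ⟨b, rfl⟩ := Submodule.Quotient.mk_surjective _ b
    obtain ⟨a, rfl⟩ := hf b
    exact ⟨Submodule.Quotient.mk a, rfl⟩

theorem isStemCover_ofSurjective (p : Hom K A B) (hp : Function.Surjective p.toLinearMap)
    (hc : commutator K p.ker.toSubmodule ⊤ = ⊥) (hd : p.ker.toSubmodule ≤ derived K A)
    (hH : p.H₁map = 0) : (Extension.ofSurjective p hp).IsStemCover := by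
  refine ⟨⟨?_, abMap_bijective p hp hd⟩, hH⟩
  unfold Extension.IsCentral
  rw [(Extension.ofSurjective p hp).exact]
  exact hc

/-- The kernel of a stem cover is isomorphic to the first homology of the base. -/
theorem nonempty_ker_equiv_H₁ (p : Hom K A B) (hp : Function.Surjective p.toLinearMap)
    (hc : commutator K p.ker.toSubmodule ⊤ = ⊥) (hd : p.ker.toSubmodule ≤ derived K A)
    (hH : p.H₁map = 0) : Nonempty (p.ker.toSubmodule ≃ₗ[K] H₁ K B) := by
  -- The section `s` is only linear. By centrality `d₁` kills the chains over zero, so `d₁ ∘ s` does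
  -- not depend on its choice.
  obtain ⟨s, hs⟩ := p.chainMap₁.exists_rightInverse_of_surjective
    (LinearMap.range_eq_top.2 (chainMap₁_surjective p hp))
  have hs : ∀ z, p.chainMap₁ (s z) = z := fun z => LinearMap.congr_fun hs z
  have hc : ∀ z, p.chainMap₁ z = 0 → d₁ K A z = 0 := fun z hz => by
    have := d₁_mem_commutator p hp hz
    rwa [hc, Submodule.mem_bot] at this
  have hL : ∀ z ∈ LinearMap.ker (d₁ K B), (d₁ K A ∘ₗ s) z ∈ p.ker.toSubmodule := fun z hz => by
    change p.toLinearMap (d₁ K A (s z)) = 0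
    rw [← d₁_chainMap_apply, hs]
    exact hz
  let L := (d₁ K A ∘ₗ s).restrict hL
  have hsurj : Function.Surjective L := by
    rintro ⟨n, hn⟩
    have hn' := hd hn
    rw [derived_eq_range] at hn'
    obtain ⟨w, rfl⟩ := hn'
    -- The kernel lies in the image of `d₁`, so its element is `d₁ w`; the preimage is the image of
    -- `w`, since `w` and its re-lift by `s` differ by a chain over zero.
    refine ⟨⟨p.chainMap₁ w, (d₁_chainMap_apply p w).trans hn⟩, Subtype.ext ?_⟩
    change d₁ K A (s (p.chainMap₁ w)) = d₁ K A w
    rw [← sub_eq_zero, ← map_sub]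
    exact hc _ (by rw [map_sub, hs, sub_self])
  have hker : LinearMap.ker L
      = (LinearMap.range (d₂ K B)).submoduleOf (LinearMap.ker (d₁ K B)) := by
    ext ⟨z, hz⟩
    have e : (⟨z, hz⟩ : LinearMap.ker (d₁ K B)) ∈ LinearMap.ker L ↔ d₁ K A (s z) = 0 :=
      Subtype.ext_iff
    rw [e]
    change _ ↔ z ∈ LinearMap.range (d₂ K B)
    -- If `d₁ (s z) = 0`, then `s z` is a cycle upstairs and its image `z` bounds because `p` is
    -- zero on homology. Conversely a boundary lifts to a boundary, on which `d₁` vanishes.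
    constructor
    · intro h
      have := (H₁map_eq_zero_iff p).1 hH _ h
      rwa [hs] at this
    · rintro ⟨y, rfl⟩
      obtain ⟨y, rfl⟩ := chainMap₂_surjective p hp y
      rw [d₂_chainMap_apply]
      have := hc (s (p.chainMap₁ (d₂ K A y)) - d₂ K A y) (by rw [map_sub, hs, sub_self])
      rwa [map_sub, d₁_d₂_apply, sub_zero] at this
  exact ⟨((Submodule.quotEquivOfEq _ _ hker.symm).trans
    (L.quotKerEquivOfSurjective hsurj)).symm⟩

end Chains

/-! ### The stem cover built from the universal cocycle -/

section Cocycles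

variable {K : Type u} [Field K]
variable {A : Type*} [AddCommGroup A] [Module K A] [AWB K A]
variable {H : Type*} [AddCommGroup H] [Module K H]

/-- The algebra with bracket on `A × H` given by a two-cocycle `(α, β)` with values in the trivial
module `H`. -/
abbrev ofCocycle (α β : A ⊗[K] A →ₗ[K] H) (h : α.coprod β ∘ₗ d₂ K A = 0) : AWB K (A × H) where
  mul := LinearMap.mk₂ K (fun x y => (mul (K := K) x.1 y.1, α (x.1 ⊗ₜ y.1)))
    (by intros; simp [TensorProduct.add_tmul]) (by intros; simp [← TensorProduct.smul_tmul'])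
    (by intros; simp [TensorProduct.tmul_add]) (by intros; simp)
  bracket := LinearMap.mk₂ K (fun x y => (bracket (K := K) x.1 y.1, β (x.1 ⊗ₜ y.1)))
    (by intros; simp [TensorProduct.add_tmul]) (by intros; simp [← TensorProduct.smul_tmul'])
    (by intros; simp [TensorProduct.tmul_add]) (by intros; simp)
  mul_assoc x y z := by
    have e := LinearMap.congr_fun h (x.1 ⊗ₜ (y.1 ⊗ₜ z.1), 0)
    rw [LinearMap.comp_apply, d₂_inl] at e
    simp only [LinearMap.coprod_apply, map_sub, map_zero, add_zero, LinearMap.zero_apply] at e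
    exact Prod.ext (AWB.mul_assoc _ _ _) (sub_eq_zero.1 e)
  bracket_mul x y z := by
    have e := LinearMap.congr_fun h (0, x.1 ⊗ₜ (y.1 ⊗ₜ z.1))
    rw [LinearMap.comp_apply, d₂_inr] at e
    simp only [LinearMap.coprod_apply, map_add, map_neg, LinearMap.zero_apply] at e
    exact Prod.ext (AWB.bracket_mul _ _ _) (add_neg_eq_zero.1 e).symm

/-- There is a linear map on chains of degree one which vanishes on boundaries and sends each cycle
to its class. -/
theorem exists_universal_cocycle (K : Type u) [Field K] (A : Type v) [AddCommGroup A] [Module K A]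
    [AWB K A] : ∃ φ : ((A ⊗[K] A) × (A ⊗[K] A)) →ₗ[K] H₁ K A,
      φ ∘ₗ d₂ K A = 0 ∧
      ∀ z (hz : z ∈ LinearMap.ker (d₁ K A)), φ z = Submodule.Quotient.mk ⟨z, hz⟩ := by
  obtain ⟨φ, hφ⟩ := LinearMap.exists_extend
    ((LinearMap.range (d₂ K A)).submoduleOf (LinearMap.ker (d₁ K A))).mkQ
  have hφ : ∀ z (hz : z ∈ LinearMap.ker (d₁ K A)), φ z = Submodule.Quotient.mk ⟨z, hz⟩ :=
    fun z hz => LinearMap.congr_fun hφ ⟨z, hz⟩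
  refine ⟨φ, LinearMap.ext fun y => ?_, hφ⟩
  rw [LinearMap.comp_apply, hφ _ (d₁_d₂_apply y)]
  exact (Submodule.Quotient.mk_eq_zero _).2 ⟨y, rfl⟩

/-- Every algebra with bracket `A` is the base of a stem cover. -/
theorem exists_stemCover (K : Type u) [Field K] (A : Type v) [AddCommGroup A] [Module K A]
    [AWB K A] : ∃ (G : Type v) (_ : AddCommGroup G) (_ : Module K G) (_ : AWB K G)
      (p : Hom K G A), Function.Surjective p.toLinearMap ∧
        commutator K p.ker.toSubmodule ⊤ = ⊥ ∧ p.ker.toSubmodule ≤ derived K G ∧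
        p.H₁map = 0 := by
  obtain ⟨φ, hd, hφ⟩ := exists_universal_cocycle K A
  set α := φ ∘ₗ LinearMap.inl K _ _ with hα
  set β := φ ∘ₗ LinearMap.inr K _ _ with hβ
  have hαβ : α.coprod β = φ := by
    rw [hα, hβ, ← LinearMap.comp_coprod, LinearMap.coprod_inl_inr, LinearMap.comp_id]
  let _ : AWB K (A × H₁ K A) := ofCocycle α β (by rw [hαβ]; exact hd)
  let p : Hom K (A × H₁ K A) A :=
    { LinearMap.fst K A (H₁ K A) with
      map_mul := fun _ _ => rfl
      map_bracket := fun _ _ => rfl }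
  have hp : Function.Surjective p.toLinearMap := Prod.fst_surjective
  -- `d₁` of the cover depends only on the image of the chain in `A`; the three properties below are
  -- read off from this formula.
  have key : ∀ z, d₁ K (A × H₁ K A) z = (d₁ K A (p.chainMap₁ z), φ (p.chainMap₁ z)) := by
    intro z
    have : d₁ K (A × H₁ K A) = ((d₁ K A).prod φ) ∘ₗ p.chainMap₁ := by
      rw [← hαβ]
      apply LinearMap.prod_ext <;> refine TensorProduct.ext' fun x y => ?_
      · change d₁ K _ (x ⊗ₜ y, 0) = _
        simp [Hom.chainMap₁]
        rfl
      · change d₁ K _ (0, x ⊗ₜ y) = _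
        simp [Hom.chainMap₁]
        rfl
    exact LinearMap.congr_fun this z
  refine ⟨A × H₁ K A, inferInstance, inferInstance, inferInstance, p, hp, ?_, ?_, ?_⟩
  · rw [eq_bot_iff]
    intro x hx
    obtain ⟨z, hz, rfl⟩ := exists_d₁_of_mem_commutator p hx
    rw [key, hz]
    simp
  · rintro ⟨a, n⟩ ha
    have ha : a = 0 := ha
    subst ha
    obtain ⟨⟨z, hz⟩, rfl⟩ := Submodule.Quotient.mk_surjective _ n
    obtain ⟨w, rfl⟩ := chainMap₁_surjective p hp z
    rw [derived_eq_range]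
    refine ⟨w, ?_⟩
    rw [key, hφ _ hz]
    exact Prod.ext hz rfl
  · rw [H₁map_eq_zero_iff]
    intro z hz
    rw [key] at hz
    obtain ⟨h₁, h₂⟩ := Prod.mk.inj hz
    -- The second coordinate says that the class of the image cycle is zero.
    rw [hφ _ h₁] at h₂
    exact (H₁_mk_eq_zero h₁).1 h₂

end Cocycles

/-! ### Universal property of the free algebra and vanishing of its homology -/

section FreeLift

variable (K : Type u) [Field K] {X : Type w}
variable {B : Type*} [AddCommGroup B] [Module K B] [AWB K B]

/-- The value of a term in an algebra with bracket. -/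
def Term.eval (f : X → B) : Term X → B
  | .of x => f x
  | .mul s t => AWB.mul (K := K) (s.eval f) (t.eval f)
  | .bracket s t => AWB.bracket (K := K) (s.eval f) (t.eval f)

/-- The value of a linear combination of terms. -/
noncomputable def evalTerms (f : X → B) : (Term X →₀ K) →ₗ[K] B :=
  Finsupp.linearCombination K (Term.eval K f)

theorem evalTerms_termMul (f : X → B) (a b : Term X →₀ K) :
    evalTerms K f (termMul K X a b) = mul (K := K) (evalTerms K f a) (evalTerms K f b) := by
  have : (termMul K X).compr₂ (evalTerms K f)
      = (mul (K := K)).compl₁₂ (evalTerms K f) (evalTerms K f) := by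
    ext s t
    simp [termMul, evalTerms, Finsupp.lmapDomain_apply, Term.eval]
  exact LinearMap.congr_fun₂ this a b

theorem evalTerms_termBracket (f : X → B) (a b : Term X →₀ K) :
    evalTerms K f (termBracket K X a b)
      = bracket (K := K) (evalTerms K f a) (evalTerms K f b) := by
  have : (termBracket K X).compr₂ (evalTerms K f)
      = (bracket (K := K)).compl₁₂ (evalTerms K f) (evalTerms K f) := by
    ext s t
    simp [termBracket, evalTerms, Finsupp.lmapDomain_apply, Term.eval]
  exact LinearMap.congr_fun₂ this a b

theorem relators_le_ker_evalTerms (f : X → B) :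
    relators K X ≤ LinearMap.ker (evalTerms K f) := by
  refine Submodule.span_le.2 fun x hx => ?_
  change evalTerms K f x = 0
  induction hx with
  | assoc a b c => simp [evalTerms_termMul, AWB.mul_assoc]
  | leibniz a b c => simp [evalTerms_termMul, evalTerms_termBracket, AWB.bracket_mul]
  | mul_left a x _ h => simp [evalTerms_termMul, h]
  | mul_right a x _ h => simp [evalTerms_termMul, h]
  | bracket_left a x _ h => simp [evalTerms_termBracket, h]
  | bracket_right a x _ h => simp [evalTerms_termBracket, h]

/-- The homomorphism on a free algebra with bracket given by the images of the generators. -/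
noncomputable def Free.lift (f : X → B) : Hom K (Free K X) B where
  toLinearMap := (relators K X).liftQ (evalTerms K f) (relators_le_ker_evalTerms K f)
  map_mul a b := by
    obtain ⟨a, rfl⟩ := Submodule.Quotient.mk_surjective _ a
    obtain ⟨b, rfl⟩ := Submodule.Quotient.mk_surjective _ b
    exact evalTerms_termMul K f a b
  map_bracket a b := by
    obtain ⟨a, rfl⟩ := Submodule.Quotient.mk_surjective _ a
    obtain ⟨b, rfl⟩ := Submodule.Quotient.mk_surjective _ b
    exact evalTerms_termBracket K f a b

/-- The generators of a free algebra with bracket. -/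
noncomputable def Free.of (x : X) : Free K X :=
  Submodule.Quotient.mk (Finsupp.single (.of x) 1)

@[simp] theorem Free.lift_of (f : X → B) (x : X) :
    (Free.lift K f).toLinearMap (Free.of K x) = f x := by
  change evalTerms K f (Finsupp.single (.of x) 1) = f x
  simp [evalTerms, Term.eval]

theorem Free.mk_single_mul (s t : Term X) :
    (Submodule.Quotient.mk (Finsupp.single (.mul s t) 1) : Free K X)
      = mul (K := K) (A := Free K X) (Submodule.Quotient.mk (Finsupp.single s 1))
          (Submodule.Quotient.mk (Finsupp.single t 1)) := by
  refine congrArg Submodule.Quotient.mk ?_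
  simp [termMul, Finsupp.lmapDomain_apply]

theorem Free.mk_single_bracket (s t : Term X) :
    (Submodule.Quotient.mk (Finsupp.single (.bracket s t) 1) : Free K X)
      = bracket (K := K) (A := Free K X) (Submodule.Quotient.mk (Finsupp.single s 1))
          (Submodule.Quotient.mk (Finsupp.single t 1)) := by
  refine congrArg Submodule.Quotient.mk ?_
  simp [termBracket, Finsupp.lmapDomain_apply]

theorem Free.hom_ext {f g : Hom K (Free K X) B}
    (h : ∀ x, f.toLinearMap (Free.of K x) = g.toLinearMap (Free.of K x)) :
    f.toLinearMap = g.toLinearMap := by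
  ext t
  change f.toLinearMap (Submodule.Quotient.mk (Finsupp.single t 1))
    = g.toLinearMap (Submodule.Quotient.mk (Finsupp.single t 1))
  induction t with
  | of x => exact h x
  | mul s t hs ht => rw [Free.mk_single_mul, f.map_mul, g.map_mul, hs, ht]
  | bracket s t hs ht => rw [Free.mk_single_bracket, f.map_bracket, g.map_bracket, hs, ht]

/-- The first homology of a free algebra with bracket vanishes. -/
theorem Free.mem_range_d₂ {z : (Free K X ⊗[K] Free K X) × (Free K X ⊗[K] Free K X)}
    (hz : d₁ K (Free K X) z = 0) : z ∈ LinearMap.range (d₂ K (Free K X)) := by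
  obtain ⟨G, _, _, _, p, hp, -, -, hH⟩ := exists_stemCover K (Free K X)
  -- Lifting the generators through the stem cover gives a section `σ` of `p`, so `z` is the image
  -- under `p` of the cycle `σ z`.
  choose s hs using fun x : X => hp (Free.of K x)
  let σ := Free.lift K s
  let one : Hom K (Free K X) (Free K X) := ⟨LinearMap.id, fun _ _ => rfl, fun _ _ => rfl⟩
  let q : Hom K (Free K X) (Free K X) :=
    ⟨p.toLinearMap ∘ₗ σ.toLinearMap, fun a b => by simp [σ.map_mul, p.map_mul],
      fun a b => by simp [σ.map_bracket, p.map_bracket]⟩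
  have e : p.toLinearMap ∘ₗ σ.toLinearMap = one.toLinearMap :=
    Free.hom_ext K (f := q) (g := one) fun x => by
      change p.toLinearMap (σ.toLinearMap _) = Free.of K x
      rw [Free.lift_of, hs]
  have h := (H₁map_eq_zero_iff p).1 hH (σ.chainMap₁ z) (by rw [d₁_chainMap_apply, hz, map_zero])
  rw [chainMap₁_comp σ p one e] at h
  have e' : one.chainMap₁ z = z := by simp [Hom.chainMap₁, one]
  rwa [e'] at h

end FreeLift

/-! ### Quotients of a free presentation -/

section FreePresentation

variable {K : Type u} [Field K]
variable {A : Type*} [AddCommGroup A] [Module K A] [AWB K A]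

/-- The quotient homomorphism. -/
def TwoSided.proj (S : TwoSided K A) : Hom K A (A ⧸ S.toSubmodule) :=
  ⟨S.toSubmodule.mkQ, fun _ _ => rfl, fun _ _ => rfl⟩

/-- A subspace of an ideal `R` that contains `[[R, A]]` is an ideal. -/
def TwoSided.between (R : TwoSided K A) (S : Submodule K A)
    (h₁ : commutator K R.toSubmodule ⊤ ≤ S) (h₂ : S ≤ R.toSubmodule) : TwoSided K A where
  toSubmodule := S
  mul_left_mem a x hx := h₁ (Submodule.subset_span ⟨x, h₂ hx, a, trivial, by tauto⟩)
  mul_right_mem a x hx := h₁ (Submodule.subset_span ⟨x, h₂ hx, a, trivial, by tauto⟩)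
  bracket_left_mem a x hx := h₁ (Submodule.subset_span ⟨x, h₂ hx, a, trivial, by tauto⟩)
  bracket_right_mem a x hx := h₁ (Submodule.subset_span ⟨x, h₂ hx, a, trivial, by tauto⟩)

variable {X : Type w}
variable {Q : Type*} [AddCommGroup Q] [Module K Q] [AWB K Q]

theorem commutator_le_derived (I J : Submodule K A) : commutator K I J ≤ derived K A := by
  refine Submodule.span_mono ?_
  rintro x ⟨i, -, j, -, h⟩
  exact ⟨i, trivial, j, trivial, h⟩

theorem commutator_ker_lift (S : TwoSided K A) (f : Hom K A Q)
    (hS : S.toSubmodule ≤ f.ker.toSubmodule)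
    (hc : commutator K f.ker.toSubmodule ⊤ ≤ S.toSubmodule) :
    commutator K (S.lift f hS).ker.toSubmodule ⊤ = ⊥ := by
  rw [eq_bot_iff]
  refine Submodule.span_le.2 ?_
  rintro x ⟨i, hi, j, -, h⟩
  obtain ⟨i, rfl⟩ := Submodule.Quotient.mk_surjective _ i
  obtain ⟨j, rfl⟩ := Submodule.Quotient.mk_surjective _ j
  have hi : i ∈ f.ker.toSubmodule := hi
  rcases h with rfl | rfl | rfl | rfl <;>
  exact (Submodule.Quotient.mk_eq_zero _).2
    (hc (Submodule.subset_span ⟨i, hi, j, trivial, by tauto⟩))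

theorem ker_lift_le_derived (S : TwoSided K A) (f : Hom K A Q)
    (hS : S.toSubmodule ≤ f.ker.toSubmodule)
    (hd : f.ker.toSubmodule ≤ S.toSubmodule ⊔ derived K A) :
    (S.lift f hS).ker.toSubmodule ≤ derived K (A ⧸ S.toSubmodule) := by
  intro x hx
  obtain ⟨x, rfl⟩ := Submodule.Quotient.mk_surjective _ x
  have hx : x ∈ f.ker.toSubmodule := hx
  obtain ⟨s, hs, y, hy, rfl⟩ := Submodule.mem_sup.1 (hd hx)
  rw [Submodule.Quotient.mk_add, (Submodule.Quotient.mk_eq_zero _).2 hs, zero_add]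
  exact S.proj.map_derived_le hy

/-- A cycle of `F/S` lifts to a chain `w` of `F` with `d₁ w` in `S ⊓ [[F, F]]`, hence in `[[R, F]]`.
Subtracting a chain `w'` that dies in `Q` turns `w` into a cycle of `F`, which bounds; so the image
in `Q` bounds. -/
theorem H₁map_lift_eq_zero (ρ : Hom K (Free K X) Q)
    (S : TwoSided K (Free K X)) (hS : S.toSubmodule ≤ ρ.ker.toSubmodule)
    (hd : S.toSubmodule ⊓ derived K (Free K X) ≤ commutator K ρ.ker.toSubmodule ⊤) :
    (S.lift ρ hS).H₁map = 0 := by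
  rw [H₁map_eq_zero_iff]
  intro z hz
  obtain ⟨w, rfl⟩ := chainMap₁_surjective S.proj (Submodule.mkQ_surjective _) z
  rw [d₁_chainMap_apply] at hz
  have hw : d₁ K _ w ∈ S.toSubmodule := (Submodule.Quotient.mk_eq_zero _).1 hz
  obtain ⟨w', h₁, h₂⟩ := exists_d₁_of_mem_commutator ρ
    (hd ⟨hw, derived_eq_range (K := K) (A := Free K X) ▸ ⟨w, rfl⟩⟩)
  obtain ⟨y, hy⟩ := Free.mem_range_d₂ K (z := w - w') (by rw [map_sub, h₂, sub_self])
  refine ⟨ρ.chainMap₂ y, ?_⟩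
  rw [d₂_chainMap_apply, hy, map_sub, h₁, sub_zero, chainMap₁_comp S.proj (S.lift ρ hS) ρ]
  rfl

end FreePresentation

end AWB

/-! ### The main theorem -/

theorem mainTheorem10 {K : Type u} [Field K] {Q : Type v} [AddCommGroup Q] [Module K Q]
    [AWB K Q] [FiniteDimensional K Q] :
    (∃ (N : Type v) (_ : AddCommGroup N) (_ : Module K N) (_ : AWB K N)
        (G : Type v) (_ : AddCommGroup G) (_ : Module K G) (_ : AWB K G)
        (E : AWB.Extension K N G Q),
        E.IsStemCover ∧ Nonempty (N ≃ₗ[K] AWB.H₁ K Q)) ∧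
    (∃ (X : Type v) (ρ : AWB.Hom K (AWB.Free K X) Q), Function.Surjective ρ.toLinearMap) ∧
    (∀ (X : Type w) (ρ : AWB.Hom K (AWB.Free K X) Q)
        (hρ : Function.Surjective ρ.toLinearMap),
        ∃ (S : AWB.TwoSided K (AWB.Free K X)) (hS : S.toSubmodule ≤ ρ.ker.toSubmodule),
          S.toSubmodule ⊓ (ρ.ker.toSubmodule ⊓ AWB.derived K (AWB.Free K X))
            = AWB.commutator K ρ.ker.toSubmodule ⊤ ∧
          S.toSubmodule ⊔ (ρ.ker.toSubmodule ⊓ AWB.derived K (AWB.Free K X))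
            = ρ.ker.toSubmodule ∧
          (AWB.Extension.ofSurjective (S.lift ρ hS) (S.lift_surjective ρ hS hρ)).IsStemCover ∧
          Nonempty ((S.lift ρ hS).ker.toSubmodule ≃ₗ[K] AWB.H₁ K Q)) := by
  refine ⟨?_, ?_, ?_⟩
  · obtain ⟨G, _, _, _, p, hp, hc, hd, hH⟩ := AWB.exists_stemCover K Q
    exact ⟨p.ker.toSubmodule, inferInstance, inferInstance, inferInstance, G, _, _, _,
      AWB.Extension.ofSurjective p hp, AWB.isStemCover_ofSurjective p hp hc hd hH,
      AWB.nonempty_ker_equiv_H₁ p hp hc hd hH⟩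
  -- The underlying set of `Q` serves as the set of generators.
  · exact ⟨Q, AWB.Free.lift K id, fun q => ⟨AWB.Free.of K q, AWB.Free.lift_of K id q⟩⟩
  · intro X ρ hρ
    -- Applied to the chain `[[R, F]] ≤ R ⊓ [[F, F]] ≤ R`.
    obtain ⟨T, h₁, h₂⟩ := exists_relative_complement
      (le_inf (AWB.commutator_le_left ρ.ker ⊤) (AWB.commutator_le_derived ρ.ker.toSubmodule ⊤))
      (inf_le_left (a := ρ.ker.toSubmodule) (b := AWB.derived K (AWB.Free K X)))
    have hc : AWB.commutator K ρ.ker.toSubmodule ⊤ ≤ T := h₁ ▸ inf_le_left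
    have hS : T ≤ ρ.ker.toSubmodule := h₂ ▸ le_sup_left
    let S := ρ.ker.between T hc hS
    have hs := S.lift_surjective ρ hS hρ
    have hcentral := AWB.commutator_ker_lift S ρ hS hc
    have hderived := AWB.ker_lift_le_derived S ρ hS
      (h₂.symm.le.trans (sup_le_sup_left inf_le_right _))
    have hH := AWB.H₁map_lift_eq_zero ρ S hS
      ((le_inf inf_le_left (le_inf (inf_le_left.trans hS) inf_le_right)).trans h₁.le)
    exact ⟨S, hS, h₁, h₂, AWB.isStemCover_ofSurjective _ hs hcentral hderived hH,
      AWB.nonempty_ker_equiv_H₁ _ hs hcentral hderived hH⟩
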